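/- **Theorem (global small-set expansion for product chains).** For every $\lambda>0$ there is $c>0$, depending only on $\lambda$, such that the following holds for every $n\ge 0$. For each $i\in[n]$ let $T_i$ be (the transition matrix of) a Markov chain on a finite set $\Omega_i$ with stationary probability distribution $\nu_i$ (so $\nu_iT_i=\nu_i$), and suppose its absolute spectral gap satisfies $\lambda_*(T_i)\ge\lambda$, where $\lambda_*(T_i)\le 1$ is defined by $$(1-\lambda_*(T_i))^2=\sup\{\mathbb E_{\nu_i}[(T_if)^2] : f:\Omega_i\to\mathbb R,\ \mathbb E_{\nu_i}f=0,\ \mathbb E_{\nu_i}f^2=1\},\qquad (T_if)(a)=\sum_b (T_i)_{ab}f(b)$$ (the supremum being $0$ if there is no such $f$). Let $\Omega=\prod_i\Omega_i$, $\nu=\prod_i\nu_i$, and let $T$ be the product chain on $\Omega$, $T_{xy}=\prod_i (T_i)_{x_iy_i}$. Let $x,y$ be consecutive states of the stationary chain for $T$, i.e. $x=X_k$, $y=X_{k+1}$ for some $k\ge0$, where $(X_j)_{j\ge 0}$ is a Markov chain with transition matrix $T$ and $X_0\sim\nu$. Let $\mu\in(0,1/16)$ and let $\mathcal F\subset\Omega$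 be $(\log(1/\mu),\mu^{1-c})$-global, where $\log$ is the natural logarithm and "$(r,\varepsilon)$-global" means that, with $f=1_{\mathcal F}$, for every $R\subset[n]$ with $|R|\le r$ and every $a\in\prod_{i\in R}\Omega_i$, the restriction $f_{R\to a}$ of $f$ obtained by fixing the coordinates in $R$ to be $a$, a function on $\prod_{i\notin R}\Omega_i$, satisfies $\|f_{R\to a}\|_2^2\le\varepsilon$, the norm being taken with respect to $\prod_{i\notin R}\nu_i$. Then $$\mathbb P(x\in\mathcal F,\ y\in\mathcal F)\le\mu^{1+c}.$$ -/

import Mathlib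

open MeasureTheory

noncomputable section

namespace GlobalSSE

/-- The expectation of `f` under the weights `ν` on a finite set. -/
def expect {S : Type*} [Fintype S] (ν : S → ℝ) (f : S → ℝ) : ℝ :=
  ∑ x, ν x * f x

/-- `T` is the transition matrix of a Markov chain on the finite set `S` (a row-stochastic matrix)
and `ν` is a stationary probability distribution of it, i.e. `ν T = ν`. -/
structure IsStationary {S : Type*} [Fintype S] [DecidableEq S]
    (T : Matrix S S ℝ) (ν : S → ℝ) : Prop where
  stochastic : T ∈ Matrix.rowStochastic ℝ S
  prob : ν ∈ stdSimplex ℝ S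
  stationary : Matrix.vecMul ν T = ν

/-- The absolute spectral gap `λ_*` of the chain `T` with stationary distribution `ν`, given by
`(1 - λ_*)² = sup {𝔼 (T f)² : 𝔼 f = 0, 𝔼 f² = 1}` (and `λ_* ≤ 1`), expectations being with
respect to `ν`. If `ν` is a point mass the set is empty, the supremum is `0` and the gap is `1`. -/
def absSpectralGap {S : Type*} [Fintype S] (T : Matrix S S ℝ) (ν : S → ℝ) : ℝ :=
  1 - Real.sqrt (sSup {v : ℝ | ∃ f : S → ℝ, expect ν f = 0 ∧ expect ν (fun x => f x ^ 2) = 1 ∧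
    v = expect ν (fun x => (T.mulVec f x) ^ 2)})

/-- The product of the weights `ν i`, a weight function on the product space. -/
def prodMeas {ι : Type*} [Fintype ι] {Ω : ι → Type*} (ν : ∀ i, Ω i → ℝ) : (∀ i, Ω i) → ℝ :=
  fun x => ∏ i, ν i (x i)

/-- The transition matrix of the product chain: each coordinate moves independently. -/
def prodChain {ι : Type*} [Fintype ι] {Ω : ι → Type*} (T : ∀ i, Matrix (Ω i) (Ω i) ℝ) :
    Matrix (∀ i, Ω i) (∀ i, Ω i) ℝ :=
  fun x y => ∏ i, T i (x i) (y i)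

/-- The restriction `f_{R → a}`, a function of the coordinates outside `R`. -/
def restrict {ι : Type*} [DecidableEq ι] {Ω : ι → Type*} (f : (∀ i, Ω i) → ℝ)
    (R : Finset ι) (a : ∀ i : {i // i ∈ R}, Ω i) : (∀ i : {i // i ∉ R}, Ω i) → ℝ :=
  fun z => f (fun i => if h : i ∈ R then a ⟨i, h⟩ else z ⟨i, h⟩)

/-- `f` is `(r, ε)`-global with respect to the product measure of the `ν i`: for every set `R` of at
most `r` coordinates and every `a ∈ Ω_R` we have `‖f_{R → a}‖₂² ≤ ε`, the norm being taken with
respect to the product of the `ν i` over the coordinates `i ∉ R`. -/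
def IsGlobalFun {ι : Type*} [Fintype ι] [DecidableEq ι] {Ω : ι → Type*} [∀ i, Fintype (Ω i)]
    (ν : ∀ i, Ω i → ℝ) (r ε : ℝ) (f : (∀ i, Ω i) → ℝ) : Prop :=
  ∀ (R : Finset ι), (R.card : ℝ) ≤ r → ∀ a : ∀ i : {i // i ∈ R}, Ω i,
    expect (prodMeas (fun i : {i // i ∉ R} => ν i)) (fun z => restrict f R a z ^ 2) ≤ ε

/-- A family `F` is `(r, ε)`-global if its characteristic function is. -/
def IsGlobal {ι : Type*} [Fintype ι] [DecidableEq ι] {Ω : ι → Type*} [∀ i, Fintype (Ω i)]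
    (ν : ∀ i, Ω i → ℝ) (r ε : ℝ) (F : Set (∀ i, Ω i)) : Prop :=
  IsGlobalFun ν r ε (F.indicator 1)

/-- `X 0, X 1, …` are random variables on the probability space `(E, P)` forming a Markov chain
with transition matrix `T` and initial distribution `ν`. The Markov property says that, given any
event on the past `(X 0, …, X (k - 1))` and given `X k = a`, the next state is `b` with
probability `T a b`. -/
structure IsMarkovChain {S : Type*} (T : Matrix S S ℝ) (ν : S → ℝ)
    {E : Type*} [MeasurableSpace E] (P : Measure E) (X : ℕ → E → S) : Prop where
  measurable : ∀ k a, MeasurableSet {e | X k e = a}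
  initial : ∀ a, P.real {e | X 0 e = a} = ν a
  markov : ∀ (k : ℕ) (H : Set (Fin k → S)) (a b : S),
    P.real {e | (fun j : Fin k => X j e) ∈ H ∧ X k e = a ∧ X (k + 1) e = b} =
      P.real {e | (fun j : Fin k => X j e) ∈ H ∧ X k e = a} * T a b

end GlobalSSE

end

/-! Let f be the indicator of the set, and let N_ρ be the product noise operator that keeps each
coordinate with weight ρ and resamples it otherwise. By Cauchy–Schwarz it is enough to bound ‖Tf‖₂.
A gap λ makes every one-coordinate chain contract at least as much as N_ρ with ρ ≥ 1 - λ
(`IsStationary.sum_mul_mulVec_sq_le_noise`). By the Schur product theorem, inequalities between sums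
of squares of linear forms tensorise (`tensor_mono`), so ‖Tf‖₂ ≤ ‖N_ρ f‖₂.

The core is global hypercontractivity, ‖N_{1/4} f‖₄⁴ ≤ ε‖f‖₂² (`sum_noise_pow_four_le_of_global`).
The fourth moment is a quadratic form in f ⊗ f, so a one-coordinate estimate (`fourth_moment_le`)
tensorises. It makes each coordinate centred, at weight 1/4, or non-centred, and Cauchy–Schwarz
leaves a weighted sum of squared energies. With k centred coordinates, one energy factor is at most
ε by globalness when k ≤ r, while for k > r the gain 4^{-k} is itself at most ε. The remaining
factors sum to at most ‖f‖₂².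

Hölder then gives ‖N_{1/2} f‖₂² ≤ ε^{5/4}. Repeated use of ‖N_ρ f‖₂² = ⟨f, N_{ρ²} f⟩ carries a power
gain to ρ near 1, halving the extra exponent each time. -/

noncomputable section

namespace GlobalSSE

/-! ### Tensorisation of inequalities between quadratic forms. -/

section Tensor

open Finset Matrix

/-- The Gram kernel `∑ j, w j * (l j x * l j y)` of a weighted family of vectors. -/
def gram {J S : Type*} [Fintype J] (w : J → ℝ) (l : J → S → ℝ) : Matrix S S ℝ :=
  Matrix.of fun x y => ∑ j, w j * (l j x * l j y)

lemma sum_gram {J S : Type*} [Fintype J] [Fintype S] (w : J → ℝ) (l : J → S → ℝ) (f : S → ℝ) :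
    ∑ x, ∑ y, gram w l x y * (f x * f y) = ∑ j, w j * (∑ x, l j x * f x) ^ 2 := by
  simp only [gram, Matrix.of_apply, sq, mul_sum, sum_mul]
  rw [sum_congr rfl fun x _ => sum_comm, sum_comm]
  refine sum_congr rfl fun j _ => sum_congr rfl fun x _ => sum_congr rfl fun y _ => ?_
  ring

lemma gram_comm {J S : Type*} [Fintype J] (w : J → ℝ) (l : J → S → ℝ) (x y : S) :
    gram w l x y = gram w l y x := by
  simp only [gram, Matrix.of_apply, mul_comm (l _ x)]

lemma posSemidef_of_symm {S : Type*} [Fintype S] {M : Matrix S S ℝ} (hs : ∀ x y, M x y = M y x)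
    (h : ∀ f : S → ℝ, 0 ≤ ∑ x, ∑ y, M x y * (f x * f y)) : M.PosSemidef := by
  rw [posSemidef_iff_dotProduct_mulVec]
  refine ⟨by ext x y; simpa using hs y x, fun f => ?_⟩
  refine (h f).trans_eq ?_
  simp only [dotProduct, mulVec, star_trivial, mul_sum]
  refine sum_congr rfl fun x _ => sum_congr rfl fun y _ => ?_
  ring

lemma sum_nonneg_of_posSemidef {S : Type*} [Fintype S] {M : Matrix S S ℝ} (h : M.PosSemidef)
    (f : S → ℝ) : 0 ≤ ∑ x, ∑ y, M x y * (f x * f y) := by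
  refine ((posSemidef_iff_dotProduct_mulVec.1 h).2 f).trans_eq ?_
  simp only [dotProduct, mulVec, star_trivial, mul_sum]
  refine sum_congr rfl fun x _ => sum_congr rfl fun y _ => ?_
  ring

/-- The Schur product is monotone on positive semidefinite matrices. -/
lemma posSemidef_prod_sub_prod {ι S : Type*} [Fintype S] (A B : ι → Matrix S S ℝ)
    (hA : ∀ i, (A i).PosSemidef) (hAB : ∀ i, (B i - A i).PosSemidef) (s : Finset ι) :
    (Matrix.of fun x y => ∏ i ∈ s, A i x y).PosSemidef ∧
      (Matrix.of fun x y => ∏ i ∈ s, B i x y - ∏ i ∈ s, A i x y).PosSemidef := by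
  classical
  induction s using Finset.induction_on with
  | empty =>
    constructor
    · refine posSemidef_of_symm (fun _ _ => rfl) fun f => ?_
      simp only [prod_empty, Matrix.of_apply, one_mul, ← sum_mul_sum]
      exact mul_self_nonneg _
    · convert PosSemidef.zero using 1
      ext; simp
  | insert i s hi ih =>
    obtain ⟨h1, h2⟩ := ih
    constructor
    · have e : (Matrix.of fun x y => ∏ j ∈ insert i s, A j x y) =
          (A i) ⊙ (Matrix.of fun x y => ∏ j ∈ s, A j x y) := by
        ext x y; simp [prod_insert hi]
      rw [e]
      exact (hA i).hadamard h1
    · have hB : (B i).PosSemidef := by simpa using (hAB i).add (hA i)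
      -- Telescoping: both summands are Schur products of positive semidefinite matrices.
      have e : (Matrix.of fun x y => ∏ j ∈ insert i s, B j x y - ∏ j ∈ insert i s, A j x y) =
          (B i - A i) ⊙ (Matrix.of fun x y => ∏ j ∈ s, A j x y) +
            (B i) ⊙ (Matrix.of fun x y => ∏ j ∈ s, B j x y - ∏ j ∈ s, A j x y) := by
        ext x y
        simp only [prod_insert hi, Matrix.of_apply, Matrix.add_apply, hadamard_apply,
          Matrix.sub_apply]
        ring
      rw [e]
      exact ((hAB i).hadamard h1).add (hB.hadamard h2)

variable {ι : Type*} [Fintype ι] [DecidableEq ι] {Ω : ι → Type*} [∀ i, Fintype (Ω i)]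

/-- The pairing of `f` with the product of the functions `l i`. -/
def tens (l : ∀ i, Ω i → ℝ) (f : (∀ i, Ω i) → ℝ) : ℝ :=
  ∑ x, (∏ i, l i (x i)) * f x

lemma sum_prod_eq_prod_sum {J : ι → Type*} [∀ i, Fintype (J i)] (F : ∀ i, J i → ℝ) :
    ∑ j : ∀ i, J i, ∏ i, F i (j i) = ∏ i, ∑ j, F i j :=
  (Fintype.prod_sum F).symm

lemma sum_tens_sq {J : ι → Type*} [∀ i, Fintype (J i)] (w : ∀ i, J i → ℝ)
    (l : ∀ i, J i → Ω i → ℝ) (f : (∀ i, Ω i) → ℝ) :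
    ∑ j : ∀ i, J i, (∏ i, w i (j i)) * tens (fun i => l i (j i)) f ^ 2 =
      ∑ x, ∑ y, (∏ i, gram (w i) (l i) (x i) (y i)) * (f x * f y) := by
  have h := sum_gram (fun j : ∀ i, J i => ∏ i, w i (j i)) (fun j x => ∏ i, l i (j i) (x i)) f
  simp only [tens]
  rw [← h]
  refine sum_congr rfl fun x _ => sum_congr rfl fun y _ => ?_
  congr 1
  simp only [gram, Matrix.of_apply, ← prod_mul_distrib]
  exact sum_prod_eq_prod_sum fun i j => w i j * (l i j (x i) * l i j (y i))

/-- Inequalities between weighted sums of squares of linear forms tensorise. -/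
theorem tensor_mono {J J' : ι → Type*} [∀ i, Fintype (J i)] [∀ i, Fintype (J' i)]
    (w : ∀ i, J i → ℝ) (l : ∀ i, J i → Ω i → ℝ) (w' : ∀ i, J' i → ℝ) (l' : ∀ i, J' i → Ω i → ℝ)
    (hw : ∀ i j, 0 ≤ w i j)
    (h : ∀ i (g : Ω i → ℝ), ∑ j, w i j * (∑ x, l i j x * g x) ^ 2 ≤
      ∑ j, w' i j * (∑ x, l' i j x * g x) ^ 2) (f : (∀ i, Ω i) → ℝ) :
    ∑ j : ∀ i, J i, (∏ i, w i (j i)) * tens (fun i => l i (j i)) f ^ 2 ≤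
      ∑ j : ∀ i, J' i, (∏ i, w' i (j i)) * tens (fun i => l' i (j i)) f ^ 2 := by
  rw [sum_tens_sq, sum_tens_sq, ← sub_nonneg]
  -- Pulling each kernel back along its coordinate projection puts all of them on one index set,
  -- where the tensor product becomes a Schur product.
  have key := (posSemidef_prod_sub_prod
    (fun i => (gram (w i) (l i)).submatrix (fun x : ∀ i, Ω i => x i) (fun x => x i))
    (fun i => (gram (w' i) (l' i)).submatrix (fun x : ∀ i, Ω i => x i) (fun x => x i))
    (fun i => (posSemidef_of_symm (gram_comm _ _) fun g => by
      rw [sum_gram]; exact sum_nonneg fun j _ => mul_nonneg (hw i j) (sq_nonneg _)).submatrix _)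
    (fun i => by
      change ((gram (w' i) (l' i) - gram (w i) (l i)).submatrix _ _).PosSemidef
      refine (posSemidef_of_symm (fun x y => ?_) fun g => ?_).submatrix _
      · rw [Matrix.sub_apply, Matrix.sub_apply, gram_comm, gram_comm (w i)]
      · simp only [Matrix.sub_apply, sub_mul, sum_sub_distrib]
        rw [sum_gram, sum_gram]
        exact sub_nonneg.2 (h i g)) univ).2
  refine (sum_nonneg_of_posSemidef key f).trans_eq ?_
  simp only [Matrix.of_apply, sub_mul, sum_sub_distrib, submatrix_apply]

lemma sum_pi_prod {A B : ι → Type*} [∀ i, Fintype (A i)] [∀ i, Fintype (B i)]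
    (F : (∀ i, A i × B i) → ℝ) :
    ∑ j, F j = ∑ a : ∀ i, A i, ∑ b : ∀ i, B i, F fun i => (a i, b i) := by
  rw [← Fintype.sum_prod_type']
  exact Fintype.sum_equiv (Equiv.arrowProdEquivProdArrow ι A B) _ _ fun _ => rfl

lemma tens_single [∀ i, DecidableEq (Ω i)] (a : ∀ i, Ω i) (f : (∀ i, Ω i) → ℝ) :
    tens (fun i x => if x = a i then 1 else 0) f = f a := by
  rw [tens, sum_eq_single a]
  · simp
  · intro x _ hx
    obtain ⟨i, hi⟩ := Function.ne_iff.1 hx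
    rw [prod_eq_zero (mem_univ i) (by simp [hi]), zero_mul]
  · simp

end Tensor

/-! ### The fourth moment on one coordinate. -/

section OneCoordinate

open Finset

variable {S : Type*} [Fintype S]

/-- The four-point inequality behind global hypercontractivity, as an inequality between positive
semidefinite forms in a function `v` of two variables. -/
lemma four_point (ν : S → ℝ) (h0 : ∀ x, 0 ≤ ν x) (h1 : ∑ x, ν x = 1) (v : S → S → ℝ) (P Q : S → ℝ)
    (a : ℝ) (hP : ∀ z, P z = ∑ r, ν r * v z r) (hQ : ∀ z, Q z = ∑ s, ν s * v s z)
    (ha : a = ∑ s, ν s * P s) :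
    ∑ z, ν z * ((v z z + P z + Q z + a) / 4) ^ 2 ≤
      1 / 4 * (∑ z, ν z * v z z) ^ 2 + 3 / 4 * ∑ s, ∑ r, ν s * ν r * v s r ^ 2 +
        1 / 4 * ∑ z, ν z * (v z z - P z - Q z + a) ^ 2 := by
  have ha' : a = ∑ s, ν s * Q s := by
    simp only [ha, hP, hQ, mul_sum]
    rw [sum_comm]
    exact sum_congr rfl fun x _ => sum_congr rfl fun y _ => by ring
  -- Orthogonal decomposition of `v` into its mean, its two marginal parts and a remainder, whose
  -- norm is dropped.
  have hsq : a ^ 2 + ∑ z, ν z * (P z - a) ^ 2 + ∑ z, ν z * (Q z - a) ^ 2 ≤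
      ∑ s, ∑ r, ν s * ν r * v s r ^ 2 := by
    have hn : 0 ≤ ∑ s, ∑ r, ν s * ν r * (v s r - (P s + Q r - a)) ^ 2 :=
      sum_nonneg fun s _ => sum_nonneg fun r _ =>
        mul_nonneg (mul_nonneg (h0 s) (h0 r)) (sq_nonneg _)
    have e1 : ∀ z, ν z * (P z - a) ^ 2 = ν z * P z ^ 2 - 2 * a * (ν z * P z) + a ^ 2 * ν z :=
      fun z => by ring
    have e2 : ∀ z, ν z * (Q z - a) ^ 2 = ν z * Q z ^ 2 - 2 * a * (ν z * Q z) + a ^ 2 * ν z :=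
      fun z => by ring
    have e3 : ∀ s, ∑ r, ν s * ν r * (v s r - (P s + Q r - a)) ^ 2 =
        ∑ r, ν s * ν r * v s r ^ 2 - ν s * P s ^ 2 + 2 * a * (ν s * P s) - a ^ 2 * ν s
          + ν s * (∑ r, ν r * Q r ^ 2) - 2 * ∑ r, Q r * ν r * (ν s * v s r) := by
      intro s
      have : ∀ r, ν s * ν r * (v s r - (P s + Q r - a)) ^ 2 =
          ν s * ν r * v s r ^ 2 - (2 * ν s * (P s - a)) * (ν r * v s r)
            + (ν s * (P s - a) ^ 2) * ν r + (2 * ν s * (P s - a)) * (ν r * Q r)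
            + ν s * (ν r * Q r ^ 2) - 2 * (Q r * ν r * (ν s * v s r)) := fun r => by ring
      simp only [this, sum_add_distrib, sum_sub_distrib, ← mul_sum, ← hP, h1, ← ha']
      ring
    simp only [e3, sum_add_distrib, sum_sub_distrib, ← mul_sum, ← sum_mul, h1, ← ha] at hn
    rw [sum_comm (f := fun s r => Q r * ν r * (ν s * v s r))] at hn
    simp only [← mul_sum, ← hQ] at hn
    have e4 : ∑ r, Q r * ν r * Q r = ∑ r, ν r * Q r ^ 2 := sum_congr rfl fun r _ => by ring
    rw [e4] at hn
    simp only [e1, e2, sum_add_distrib, sum_sub_distrib, ← mul_sum, h1, ← ha, ← ha']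
    linarith
  -- With p = P - a, q = Q - a and d = v - P - Q + a, the terms in a agree on both sides. What
  -- remains is ((p + q)/2 + d/4)² ≤ (3p² + 3q² + d²)/4.
  have hpt : ∀ z, ν z * ((v z z + P z + Q z + a) / 4) ^ 2 ≤
      a / 2 * (ν z * P z) + a / 2 * (ν z * Q z) + a / 2 * (ν z * v z z) - a ^ 2 / 2 * ν z +
      3 / 4 * (ν z * (P z - a) ^ 2) + 3 / 4 * (ν z * (Q z - a) ^ 2) +
      1 / 4 * (ν z * (v z z - P z - Q z + a) ^ 2) := fun z => by
    have : ((v z z + P z + Q z + a) / 4) ^ 2 ≤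
      a / 2 * P z + a / 2 * Q z + a / 2 * v z z - a ^ 2 / 2 +
      3 / 4 * (P z - a) ^ 2 + 3 / 4 * (Q z - a) ^ 2 +
      1 / 4 * (v z z - P z - Q z + a) ^ 2 := by
      obtain ⟨p, hp⟩ : ∃ p, p = P z - a := ⟨_, rfl⟩
      obtain ⟨q, hq⟩ : ∃ q, q = Q z - a := ⟨_, rfl⟩
      obtain ⟨d, hd⟩ : ∃ d, d = v z z - P z - Q z + a := ⟨_, rfl⟩
      have e1 : P z = p + a := by linarith
      have e2 : Q z = q + a := by linarith
      have e3 : v z z = d + p + q + a := by linarith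
      rw [e1, e2, e3]
      nlinarith [sq_nonneg (p - q), sq_nonneg (p + q - d), sq_nonneg d]
    have := mul_le_mul_of_nonneg_left this (h0 z)
    linarith
  refine (sum_le_sum fun z _ => hpt z).trans ?_
  simp only [sum_add_distrib, sum_sub_distrib, ← mul_sum, h1, ← ha, ← ha']
  nlinarith [sq_nonneg ((∑ z, ν z * v z z) - a)]

lemma sq_sum_le (ν : S → ℝ) (h0 : ∀ x, 0 ≤ ν x) (h1 : ∑ x, ν x = 1) (g : S → ℝ) :
    (∑ x, ν x * g x) ^ 2 ≤ ∑ x, ν x * g x ^ 2 := by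
  have h := sum_nonneg fun x (_ : x ∈ univ) => mul_nonneg (h0 x) (sq_nonneg (g x - ∑ y, ν y * g y))
  obtain ⟨m, hm⟩ : ∃ m, m = ∑ x, ν x * g x := ⟨_, rfl⟩
  rw [← hm] at h ⊢
  have e : ∀ a, ν a * (g a - m) ^ 2 = ν a * g a ^ 2 - 2 * m * (ν a * g a) + m ^ 2 * ν a :=
    fun a => by ring
  simp only [e, sum_add_distrib, sum_sub_distrib, ← mul_sum, h1, ← hm] at h
  linarith

variable [DecidableEq S]

/-- The transition kernel of the noise operator on one coordinate. -/
def noiseKer (ρ : ℝ) (ν : S → ℝ) (a x : S) : ℝ :=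
  ρ * (if x = a then 1 else 0) + (1 - ρ) * ν x

lemma sum_noiseKer_mul (ρ : ℝ) (ν : S → ℝ) (a : S) (g : S → ℝ) :
    ∑ x, noiseKer ρ ν a x * g x = ρ * g a + (1 - ρ) * ∑ x, ν x * g x := by
  simp only [noiseKer, add_mul, sum_add_distrib, mul_assoc, ← mul_sum]
  simp

/-- The noise operator is self-adjoint and noise rates multiply under composition. -/
lemma gram_noiseKer (ρ : ℝ) (ν : S → ℝ) (h1 : ∑ x, ν x = 1) (x y : S) :
    gram ν (noiseKer ρ ν) x y = ν x * noiseKer (ρ ^ 2) ν x y := by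
  simp only [gram, Matrix.of_apply, noiseKer]
  have : ∀ a, ν a * ((ρ * (if x = a then 1 else 0) + (1 - ρ) * ν x) *
      (ρ * (if y = a then 1 else 0) + (1 - ρ) * ν y)) =
      (if x = a then ρ * ν a * (ρ * (if y = a then 1 else 0) + (1 - ρ) * ν y) else 0) +
      (if y = a then ρ * ν a * ((1 - ρ) * ν x) else 0) + (1 - ρ) ^ 2 * ν x * ν y * ν a := by
    intro a; split_ifs <;> ring
  simp only [this, sum_add_distrib, ← mul_sum, h1, sum_ite_eq, mem_univ, if_true]
  ring

lemma sum_noiseKer_sq (ρ : ℝ) (ν : S → ℝ) (h1 : ∑ x, ν x = 1) (g : S → ℝ) :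
    ∑ a, ν a * (∑ x, noiseKer ρ ν a x * g x) ^ 2 =
      ρ ^ 2 * ∑ x, ν x * g x ^ 2 + (1 - ρ ^ 2) * (∑ x, ν x * g x) ^ 2 := by
  simp only [sum_noiseKer_mul]
  obtain ⟨m, hm⟩ : ∃ m, m = ∑ x, ν x * g x := ⟨_, rfl⟩
  rw [← hm]
  have : ∀ a, ν a * (ρ * g a + (1 - ρ) * m) ^ 2 = ρ ^ 2 * (ν a * g a ^ 2) +
    2 * ρ * (1 - ρ) * m * (ν a * g a) + (1 - ρ) ^ 2 * m ^ 2 * ν a := fun a => by ring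
  simp only [this, sum_add_distrib, ← mul_sum, h1, ← hm]
  ring

/-- The vectors whose (weighted) products make up the forms that dominate the fourth moment on one
coordinate: `none` stands for the centred noise, `some false` for a pairing of the two
arguments of the form, `some true` for free arguments. -/
def splitVec (ν : S → ℝ) : Option Bool → S → S → S → S → ℝ
  | none, z, _, _ => fun x => 1 / 2 * (if x = z then 1 else 0) - 1 / 2 * ν x
  | some false, _, _, s => noiseKer (1 / 2) ν s
  | some true, _, p, _ => noiseKer (1 / 2) ν p

/-- The weights of the forms that dominate the fourth moment. -/
def splitWt : Option Bool → ℝ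
  | none => 1 / 4
  | some false => 1 / 4
  | some true => 3 / 4

/-- The fourth moment of the noise operator on one coordinate, as a form in functions of two
variables, is dominated by forms with factored coefficients. -/
lemma fourth_moment_le (ν : S → ℝ) (h0 : ∀ x, 0 ≤ ν x) (h1 : ∑ x, ν x = 1) (g : S × S → ℝ) :
    ∑ z, ν z * (∑ x : S × S, noiseKer (1 / 4) ν z x.1 * noiseKer (1 / 4) ν z x.2 * g x) ^ 2 ≤
    ∑ j : (Option Bool × S) × (S × S), splitWt j.1.1 * ν j.1.2 * (ν j.2.1 * ν j.2.2) *
      (∑ x : S × S, (∑ s, ν s * (splitVec ν j.1.1 j.1.2 j.2.1 s x.1 *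
        splitVec ν j.1.1 j.1.2 j.2.2 s x.2)) * g x) ^ 2 := by
  obtain ⟨B, hB⟩ : ∃ B : (S → ℝ) → (S → ℝ) → ℝ, ∀ b c, B b c = ∑ x : S × S, b x.1 * c x.2 * g x :=
    ⟨_, fun _ _ => rfl⟩
  have hl : ∀ (r r' : ℝ) b b' c, B (fun x => r * b x + r' * b' x) c = r * B b c + r' * B b' c := by
    intro r r' b b' c
    simp only [hB, mul_sum, ← sum_add_distrib]
    exact sum_congr rfl fun x _ => by ring
  have hr : ∀ (r r' : ℝ) b b' c, B c (fun x => r * b x + r' * b' x) = r * B c b + r' * B c b' := by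
    intro r r' b b' c
    simp only [hB, mul_sum, ← sum_add_distrib]
    exact sum_congr rfl fun x _ => by ring
  have hsl : ∀ (b : S → S → ℝ) c, B (fun x => ∑ s, ν s * b s x) c = ∑ s, ν s * B (b s) c := by
    intro b c
    simp only [hB, mul_sum, sum_mul]
    rw [sum_comm]
    exact sum_congr rfl fun s _ => sum_congr rfl fun x _ => by ring
  have hsr : ∀ (b : S → S → ℝ) c, B c (fun x => ∑ s, ν s * b s x) = ∑ s, ν s * B c (b s) := by
    intro b c
    simp only [hB, mul_sum, sum_mul]
    rw [sum_comm]
    exact sum_congr rfl fun s _ => sum_congr rfl fun x _ => by ring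
  have hd : ∀ b c : S → S → ℝ, ∑ x : S × S, (∑ s, ν s * (b s x.1 * c s x.2)) * g x =
      ∑ s, ν s * B (b s) (c s) := by
    intro b c
    simp only [hB, mul_sum, sum_mul]
    rw [sum_comm]
    exact sum_congr rfl fun s _ => sum_congr rfl fun x _ => by ring
  obtain ⟨t, ht⟩ : ∃ t : S → S → ℝ, t = noiseKer (1 / 2) ν := ⟨_, rfl⟩
  have hν : ν = fun x => ∑ s, ν s * t s x := by
    funext x
    have e : ∀ s, ν s * t s x = (1 / 2) * (if x = s then ν s else 0) + (1 / 2 * ν x) * ν s := by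
      intro s; simp only [ht, noiseKer]; split_ifs <;> ring
    simp only [e, sum_add_distrib, ← mul_sum, h1, sum_ite_eq, mem_univ, if_true]
    ring
  -- Noise at rate 1/4 is half noise at rate 1/2 plus half the mean. Squaring this produces the four
  -- terms of `four_point`.
  have ha : ∀ z, noiseKer (1 / 4) ν z = fun x => 1 / 2 * t z x + 1 / 2 * ν x := by
    intro z; funext x; simp only [ht, noiseKer]; ring
  have hc : ∀ z, (fun x => 1 / 2 * (if x = z then 1 else 0) - 1 / 2 * ν x) =
      fun x => 1 * t z x + (-1) * ν x := by
    intro z; funext x; simp only [ht, noiseKer]; ring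
  have h4 := four_point ν h0 h1 (fun s r => B (t s) (t r)) (fun s => B (t s) ν)
    (fun r => B ν (t r)) (B ν ν)
    (fun z => by conv_lhs => rw [hν, hsr])
    (fun z => by conv_lhs => rw [hν, hsl])
    (by conv_lhs => rw [hν, hsl, ← hν])
  refine le_of_eq_of_le ?_ (h4.trans_eq ?_)
  · refine sum_congr rfl fun z _ => ?_
    rw [← hB, ha, hl, hr, hr]
    ring
  · have hk : ∀ k z p q, ∑ x : S × S, (∑ s, ν s * (splitVec ν k z p s x.1 *
        splitVec ν k z q s x.2)) * g x =
        ∑ s, ν s * B (splitVec ν k z p s) (splitVec ν k z q s) := fun k z p q => hd _ _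
    have hone : ∀ c : ℝ, ∑ s, ν s * c = c := fun c => by rw [← sum_mul, h1, one_mul]
    have hnone : ∀ z p q, ∑ s, ν s * B (splitVec ν none z p s) (splitVec ν none z q s) =
        B (t z) (t z) - B (t z) ν - B ν (t z) + B ν ν := by
      intro z p q
      simp only [splitVec, hone]
      rw [hc, hl, hr, hr]
      ring
    have hfalse : ∀ z p q, ∑ s, ν s * B (splitVec ν (some false) z p s)
        (splitVec ν (some false) z q s) = ∑ s, ν s * B (t s) (t s) := fun z p q => by
      simp only [splitVec, ht]
    have htrue : ∀ z p q, ∑ s, ν s * B (splitVec ν (some true) z p s)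
        (splitVec ν (some true) z q s) = B (t p) (t q) := fun z p q => by
      simp only [splitVec, ht, hone]
    simp only [Fintype.sum_prod_type, hk, Fintype.sum_option, Fintype.sum_bool, hnone, hfalse,
      htrue, splitWt, mul_assoc, ← mul_sum, hone]
    ring

end OneCoordinate

/-! ### Global hypercontractivity on the product space. -/

section Product

open Finset

/-- Weights on one coordinate dominating the squares of the pairings with `splitVec`. -/
def splitDiag {S : Type*} [DecidableEq S] (ν : S → ℝ) : Option Bool → S → S → ℝ
  | none, z, x => 1 / 2 * (if x = z then 1 else 0) + 1 / 2 * ν x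
  | some _, _, x => ν x

/-- The weights `splitWt` without the gain for centred coordinates. -/
def splitWtOne : Option Bool → ℝ
  | none => 1
  | some false => 1 / 4
  | some true => 3 / 4

lemma splitWtOne_nonneg (k : Option Bool) : 0 ≤ splitWtOne k := by
  rcases k with _ | _ | _ <;> norm_num [splitWtOne]

lemma splitWt_nonneg (k : Option Bool) : 0 ≤ splitWt k := by
  rcases k with _ | _ | _ <;> norm_num [splitWt]

/-- Isolates the gain of 1/4 per centred coordinate that pays for exceeding the globalness
threshold. -/
lemma splitWt_eq (k : Option Bool) : splitWt k = (if k = none then 1 / 4 else 1) * splitWtOne k := by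
  rcases k with _ | _ | _ <;> simp [splitWt, splitWtOne]

section OneCoordinate

variable {S : Type*} [Fintype S] [DecidableEq S] (ν : S → ℝ)

lemma sum_splitVec_none (z p s : S) (g : S → ℝ) :
    ∑ x, splitVec ν none z p s x * g x = 1 / 2 * g z - 1 / 2 * ∑ x, ν x * g x := by
  simp only [splitVec, sub_mul, sum_sub_distrib, mul_assoc, ← mul_sum]
  simp

lemma sum_sum_splitVec_some (h1 : ∑ x, ν x = 1) (b : Bool) (z : S) (g : S → ℝ) :
    ∑ p, ∑ s, ν p * ν s * (∑ x, splitVec ν (some b) z p s x * g x) ^ 2 =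
      1 / 4 * ∑ x, ν x * g x ^ 2 + 3 / 4 * (∑ x, ν x * g x) ^ 2 := by
  have h := sum_noiseKer_sq (1 / 2) ν h1 g
  cases b
  · simp only [splitVec, mul_assoc, ← mul_sum]
    rw [← sum_mul, h1, h]
    ring
  · simp only [splitVec, mul_assoc, ← mul_sum, ← sum_mul, h1]
    simp only [one_mul, h]
    ring

lemma sum_sum_splitVec_le (h0 : ∀ x, 0 ≤ ν x) (h1 : ∑ x, ν x = 1) (k : Option Bool) (z : S)
    (g : S → ℝ) :
    ∑ p, ∑ s, ν p * ν s * (∑ x, splitVec ν k z p s x * g x) ^ 2 ≤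
      ∑ x, splitDiag ν k z x * g x ^ 2 := by
  have hs := sq_sum_le ν h0 h1 g
  rcases k with _ | b
  · simp only [sum_splitVec_none, ← sum_mul, ← mul_sum, h1, one_mul, splitDiag, add_mul,
      sum_add_distrib, mul_assoc]
    simp only [ite_mul, one_mul, zero_mul, sum_ite_eq', mem_univ, if_true]
    nlinarith [sq_nonneg (g z + ∑ x, ν x * g x)]
  · rw [sum_sum_splitVec_some ν h1]
    simp only [splitDiag]
    linarith

/-- With m the mean, the centred part contributes (𝔼g² - m²)/4 and the other two together 𝔼g²/4 +
3m²/4, for a total of (𝔼g² + m²)/2. Thus the energies stay summable without the gain of 1/4. -/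
lemma sum_splitWtOne_le (h0 : ∀ x, 0 ≤ ν x) (h1 : ∑ x, ν x = 1) (g : S → ℝ) :
    ∑ k, ∑ z, ∑ p, ∑ s, splitWtOne k * ν z * (ν p * ν s) * (∑ x, splitVec ν k z p s x * g x) ^ 2 ≤
      ∑ x, ν x * g x ^ 2 := by
  have hs := sq_sum_le ν h0 h1 g
  have h : ∀ k z, ∑ p, ∑ s, splitWtOne k * ν z * (ν p * ν s) *
      (∑ x, splitVec ν k z p s x * g x) ^ 2 = splitWtOne k * ν z *
      ∑ p, ∑ s, ν p * ν s * (∑ x, splitVec ν k z p s x * g x) ^ 2 := by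
    intro k z
    simp only [mul_sum, mul_assoc]
  simp only [h]
  simp only [Fintype.sum_option, Fintype.sum_bool, sum_sum_splitVec_some ν h1, ← sum_mul,
    ← mul_sum, h1, splitWtOne, sum_splitVec_none, one_mul, mul_one]
  obtain ⟨m, hm⟩ : ∃ m, m = ∑ x, ν x * g x := ⟨_, rfl⟩
  rw [← hm] at hs ⊢
  have e : ∀ z, ν z * (1 / 2 * g z - 1 / 2 * m) ^ 2 =
      1 / 4 * (ν z * g z ^ 2) - 1 / 2 * m * (ν z * g z) + 1 / 4 * m ^ 2 * ν z := fun z => by ring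
  simp only [e, sum_add_distrib, sum_sub_distrib, ← mul_sum, h1, ← hm]
  linarith

end OneCoordinate

variable {ι : Type*} [Fintype ι] [DecidableEq ι] {Ω : ι → Type*} [∀ i, Fintype (Ω i)]

omit [DecidableEq ι] [∀ i, Fintype (Ω i)] in
lemma prodMeas_nonneg {ν : ∀ i, Ω i → ℝ} (h0 : ∀ i x, 0 ≤ ν i x) (x : ∀ i, Ω i) :
    0 ≤ prodMeas ν x :=
  prod_nonneg fun i _ => h0 i _

lemma tens_mul (b c : ∀ i, Ω i → ℝ) (f : (∀ i, Ω i) → ℝ) :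
    tens (Ω := fun i => Ω i × Ω i) (fun i x => b i x.1 * c i x.2)
      (fun x => f (fun i => (x i).1) * f fun i => (x i).2) = tens b f * tens c f := by
  simp only [tens]
  rw [sum_pi_prod, sum_mul_sum]
  refine sum_congr rfl fun x _ => sum_congr rfl fun y _ => ?_
  rw [prod_mul_distrib]
  ring

lemma tens_sum {J : ι → Type*} [∀ i, Fintype (J i)] (w : ∀ i, J i → ℝ) (b : ∀ i, J i → Ω i → ℝ)
    (f : (∀ i, Ω i) → ℝ) :
    tens (fun i x => ∑ s, w i s * b i s x) f =
      ∑ s : ∀ i, J i, (∏ i, w i (s i)) * tens (fun i => b i (s i)) f := by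
  simp only [tens, mul_sum]
  rw [sum_comm]
  refine sum_congr rfl fun x _ => ?_
  rw [← sum_prod_eq_prod_sum (fun i s => w i s * b i s (x i)), sum_mul]
  refine sum_congr rfl fun s _ => ?_
  rw [prod_mul_distrib, mul_assoc]

lemma sum_mul_sq_le {X : Type*} [Fintype X] (w b c : X → ℝ) (hw : ∀ x, 0 ≤ w x) :
    (∑ x, w x * (b x * c x)) ^ 2 ≤ (∑ x, w x * b x ^ 2) * ∑ x, w x * c x ^ 2 := by
  refine sum_sq_le_sum_mul_sum_of_sq_le_mul univ (fun x _ => mul_nonneg (hw x) (sq_nonneg _))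
    (fun x _ => mul_nonneg (hw x) (sq_nonneg _)) fun x _ => le_of_eq ?_
  ring

variable [∀ i, DecidableEq (Ω i)]

/-- The noise operator on a product space. -/
def noise (ρ : ℝ) (ν : ∀ i, Ω i → ℝ) (f : (∀ i, Ω i) → ℝ) (a : ∀ i, Ω i) : ℝ :=
  tens (fun i => noiseKer ρ (ν i) (a i)) f

/-- The energy of `f` after splitting each coordinate according to `c`, where the centred
coordinates are fixed to be those of `z`. -/
def splitEnergy (ν : ∀ i, Ω i → ℝ) (f : (∀ i, Ω i) → ℝ) (c : ι → Option Bool) (z : ∀ i, Ω i) : ℝ :=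
  ∑ p, ∑ s, prodMeas ν p * prodMeas ν s *
    tens (fun i => splitVec (ν i) (c i) (z i) (p i) (s i)) f ^ 2

variable {ν : ∀ i, Ω i → ℝ} (h0 : ∀ i x, 0 ≤ ν i x) (h1 : ∀ i, ∑ x, ν i x = 1)

include h1 in
lemma sum_noise_sq (ρ : ℝ) (f : (∀ i, Ω i) → ℝ) :
    ∑ a, prodMeas ν a * noise ρ ν f a ^ 2 = ∑ a, prodMeas ν a * (f a * noise (ρ ^ 2) ν f a) := by
  have h := sum_tens_sq ν (fun i => noiseKer ρ (ν i)) f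
  simp only [gram_noiseKer _ _ (h1 _)] at h
  refine Eq.trans h ?_
  refine sum_congr rfl fun x _ => ?_
  simp only [noise, tens, mul_sum, prod_mul_distrib, prodMeas]
  exact sum_congr rfl fun y _ => by ring

include h0 in
lemma splitEnergy_nonneg (f : (∀ i, Ω i) → ℝ) (c : ι → Option Bool) (z : ∀ i, Ω i) :
    0 ≤ splitEnergy ν f c z :=
  sum_nonneg fun p _ => sum_nonneg fun s _ => mul_nonneg
    (mul_nonneg (prodMeas_nonneg h0 p) (prodMeas_nonneg h0 s)) (sq_nonneg _)

include h0 h1 in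
/-- The fourth moment of the noise operator is controlled by the split energies. -/
theorem sum_noise_pow_four_le (f : (∀ i, Ω i) → ℝ) :
    ∑ a, prodMeas ν a * noise (1 / 4) ν f a ^ 4 ≤
      ∑ c : ι → Option Bool, ∑ z, (∏ i, splitWt (c i)) * prodMeas ν z * splitEnergy ν f c z ^ 2 := by
  -- The square of the noise at a point is linear in f ⊗ f, so tensorisation takes place on the
  -- doubled space.
  have h := tensor_mono (Ω := fun i => Ω i × Ω i) (J := Ω)
    (J' := fun i => (Option Bool × Ω i) × (Ω i × Ω i)) ν
    (fun i z x => noiseKer (1 / 4) (ν i) z x.1 * noiseKer (1 / 4) (ν i) z x.2)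
    (fun i j => splitWt j.1.1 * ν i j.1.2 * (ν i j.2.1 * ν i j.2.2))
    (fun i j x => ∑ s, ν i s * (splitVec (ν i) j.1.1 j.1.2 j.2.1 s x.1 *
        splitVec (ν i) j.1.1 j.1.2 j.2.2 s x.2))
    h0 (fun i g => fourth_moment_le (ν i) (h0 i) (h1 i) g)
    (fun x => f (fun i => (x i).1) * f fun i => (x i).2)
  refine le_trans (le_of_eq ?_) (h.trans ?_)
  · refine sum_congr rfl fun a _ => ?_
    rw [tens_mul (fun i => noiseKer (1 / 4) (ν i) (a i)) (fun i => noiseKer (1 / 4) (ν i) (a i)) f]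
    simp only [noise, prodMeas]
    ring
  · rw [sum_pi_prod, sum_pi_prod]
    refine sum_le_sum fun c _ => sum_le_sum fun z _ => ?_
    rw [sum_pi_prod]
    have hX : splitEnergy ν f c z ^ 2 = ∑ p, ∑ q, (prodMeas ν p * prodMeas ν q) *
        ((∑ s, prodMeas ν s * tens (fun i => splitVec (ν i) (c i) (z i) (p i) (s i)) f ^ 2) *
        (∑ s, prodMeas ν s * tens (fun i => splitVec (ν i) (c i) (z i) (q i) (s i)) f ^ 2)) := by
      have hG : splitEnergy ν f c z = ∑ p, prodMeas ν p *
          ∑ s, prodMeas ν s * tens (fun i => splitVec (ν i) (c i) (z i) (p i) (s i)) f ^ 2 := by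
        simp only [splitEnergy, mul_assoc, ← mul_sum]
      rw [hG, sq, sum_mul_sum]
      exact sum_congr rfl fun p _ => sum_congr rfl fun q _ => by ring
    rw [hX]
    simp only [mul_sum (s := univ (α := ∀ i, Ω i)) (a := (∏ i, splitWt (c i)) * prodMeas ν z)]
    refine sum_le_sum fun p _ => sum_le_sum fun q _ => ?_
    have e : (∏ i, splitWt (c i) * ν i (z i) * (ν i (p i) * ν i (q i))) =
        (∏ i, splitWt (c i)) * prodMeas ν z * (prodMeas ν p * prodMeas ν q) := by
      simp only [prod_mul_distrib, prodMeas]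
    rw [e, mul_assoc]
    have hw : 0 ≤ (∏ i, splitWt (c i)) * prodMeas ν z :=
      mul_nonneg (prod_nonneg fun i _ => splitWt_nonneg _) (prodMeas_nonneg h0 z)
    refine mul_le_mul_of_nonneg_left ?_ hw
    refine mul_le_mul_of_nonneg_left ?_
      (mul_nonneg (prodMeas_nonneg h0 p) (prodMeas_nonneg h0 q))
    -- For fixed `p` and `q`, Cauchy–Schwarz in the shared variable `s` separates the two copies of
    -- f.
    rw [tens_sum ν (fun i s (x : Ω i × Ω i) => splitVec (ν i) (c i) (z i) (p i) s x.1 *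
        splitVec (ν i) (c i) (z i) (q i) s x.2)]
    simp only [tens_mul]
    exact sum_mul_sq_le (prodMeas ν) _ _ (prodMeas_nonneg h0)

include h0 h1 in
lemma splitEnergy_le (f : (∀ i, Ω i) → ℝ) (c : ι → Option Bool) (z : ∀ i, Ω i) :
    splitEnergy ν f c z ≤ ∑ x, (∏ i, splitDiag (ν i) (c i) (z i) (x i)) * f x ^ 2 := by
  have h := tensor_mono (J := fun i => Ω i × Ω i) (J' := Ω) (fun i j => ν i j.1 * ν i j.2)
    (fun i j => splitVec (ν i) (c i) (z i) j.1 j.2) (fun i => splitDiag (ν i) (c i) (z i))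
    (fun i a x => if x = a then 1 else 0) (fun i j => mul_nonneg (h0 i _) (h0 i _))
    (fun i g => by
      simpa [Fintype.sum_prod_type] using
        sum_sum_splitVec_le (ν i) (h0 i) (h1 i) (c i) (z i) g) f
  simp only [tens_single] at h
  refine le_trans (le_of_eq ?_) h
  rw [sum_pi_prod]
  simp only [splitEnergy, prodMeas, prod_mul_distrib]

include h0 h1 in
lemma sum_splitEnergy_le (f : (∀ i, Ω i) → ℝ) :
    ∑ c : ι → Option Bool, ∑ z, (∏ i, splitWtOne (c i)) * prodMeas ν z * splitEnergy ν f c z ≤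
      ∑ x, prodMeas ν x * f x ^ 2 := by
  have h := tensor_mono (J := fun i => (Option Bool × Ω i) × (Ω i × Ω i)) (J' := Ω)
    (fun i j => splitWtOne j.1.1 * ν i j.1.2 * (ν i j.2.1 * ν i j.2.2))
    (fun i j => splitVec (ν i) j.1.1 j.1.2 j.2.1 j.2.2) ν
    (fun i a x => if x = a then 1 else 0)
    (fun i j => mul_nonneg (mul_nonneg (splitWtOne_nonneg _) (h0 i _))
      (mul_nonneg (h0 i _) (h0 i _)))
    (fun i g => by
      have := sum_splitWtOne_le (ν i) (h0 i) (h1 i) g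
      simp only [Fintype.sum_prod_type]
      simpa using this) f
  simp only [tens_single] at h
  refine le_trans (le_of_eq ?_) h
  rw [sum_pi_prod, sum_pi_prod]
  refine sum_congr rfl fun c _ => sum_congr rfl fun z _ => ?_
  rw [sum_pi_prod]
  simp only [splitEnergy, prodMeas, prod_mul_distrib, mul_sum]
  exact sum_congr rfl fun p _ => sum_congr rfl fun s _ => by ring

/-- The energy of `f` with the coordinates in `R` fixed to be those of `z`. -/
def fixedEnergy (ν : ∀ i, Ω i → ℝ) (f : (∀ i, Ω i) → ℝ) (R : Finset ι) (z : ∀ i, Ω i) : ℝ :=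
  ∑ x, (∏ i, if i ∈ R then (if x i = z i then 1 else 0) else ν i (x i)) * f x ^ 2

include h0 h1 in
lemma fixedEnergy_le_one {f : (∀ i, Ω i) → ℝ} (hf : ∀ x, f x ^ 2 ≤ 1) (R : Finset ι)
    (z : ∀ i, Ω i) : fixedEnergy ν f R z ≤ 1 := by
  calc fixedEnergy ν f R z
      ≤ ∑ x : ∀ i, Ω i, ∏ i, (if i ∈ R then (if x i = z i then 1 else 0) else ν i (x i)) := by
        refine sum_le_sum fun x _ => mul_le_of_le_one_right (prod_nonneg fun i _ => ?_) (hf x)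
        split_ifs
        exacts [zero_le_one, le_rfl, h0 i _]
    _ = 1 := by
        rw [sum_prod_eq_prod_sum fun i y => if i ∈ R then (if y = z i then 1 else 0) else ν i y]
        refine prod_eq_one fun i _ => ?_
        split_ifs
        · simp
        · exact h1 i

/-- The diagonal form `splitDiag` averages the energies of the restrictions of `f` to subsets of
the centred coordinates. -/
lemma sum_splitDiag_le (f : (∀ i, Ω i) → ℝ) (c : ι → Option Bool) (z : ∀ i, Ω i) (B : ℝ)
    (hB : ∀ R : Finset ι, R ⊆ univ.filter (fun i => c i = none) → fixedEnergy ν f R z ≤ B) :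
    ∑ x, (∏ i, splitDiag (ν i) (c i) (z i) (x i)) * f x ^ 2 ≤ B := by
  -- Expanding the product averages over a random `R` that contains each centred coordinate
  -- independently with probability 1/2.
  set α : ι → ℝ := fun i => if c i = none then 1 / 2 else 0 with hα
  have hα0 : ∀ i, 0 ≤ α i := fun i => by simp only [hα]; split_ifs <;> norm_num
  have hα1 : ∀ i, 0 ≤ 1 - α i := fun i => by simp only [hα]; split_ifs <;> norm_num
  have hd : ∀ i x, splitDiag (ν i) (c i) (z i) x =
      α i * (if x = z i then 1 else 0) + (1 - α i) * ν i x := by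
    intro i x
    rcases h : c i with _ | b
    · simp only [splitDiag, hα, h, if_true]; ring
    · simp [splitDiag, hα, h]
  have hsum : ∑ R : Finset ι, (∏ i ∈ R, α i) * ∏ i ∈ Rᶜ, (1 - α i) = 1 := by
    rw [← Fintype.prod_add]
    simp
  have key : ∑ x, (∏ i, splitDiag (ν i) (c i) (z i) (x i)) * f x ^ 2 =
      ∑ R : Finset ι, ((∏ i ∈ R, α i) * ∏ i ∈ Rᶜ, (1 - α i)) * fixedEnergy ν f R z := by
    simp only [fixedEnergy, mul_sum]
    rw [sum_comm]
    refine sum_congr rfl fun x _ => ?_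
    simp only [hd]
    rw [Fintype.prod_add, sum_mul]
    refine sum_congr rfl fun R _ => ?_
    have : (∏ i, if i ∈ R then (if x i = z i then (1 : ℝ) else 0) else ν i (x i)) =
        (∏ i ∈ R, if x i = z i then 1 else 0) * ∏ i ∈ Rᶜ, ν i (x i) := by
      rw [← prod_mul_prod_compl R]
      congr 1
      · exact prod_congr rfl fun i hi => by rw [if_pos hi]
      · exact prod_congr rfl fun i hi => by rw [if_neg (mem_compl.1 hi)]
    rw [this, prod_mul_distrib, prod_mul_distrib]
    ring
  rw [key]
  calc _ ≤ ∑ R : Finset ι, ((∏ i ∈ R, α i) * ∏ i ∈ Rᶜ, (1 - α i)) * B := by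
        refine sum_le_sum fun R _ => ?_
        by_cases hR : R ⊆ univ.filter (fun i => c i = none)
        · exact mul_le_mul_of_nonneg_left (hB R hR) (mul_nonneg (prod_nonneg fun i _ => hα0 i)
            (prod_nonneg fun i _ => hα1 i))
        · obtain ⟨i, hi, hi'⟩ := not_subset.1 hR
          have : α i = 0 := by simpa [hα] using hi'
          rw [prod_eq_zero hi this]
          simp
    _ = B := by rw [← sum_mul, hsum, one_mul]

include h0 h1 in
/-- Global hypercontractivity: the fourth moment of the noise operator of a bounded function all
of whose restrictions of at most `r` coordinates have small energy. -/
theorem sum_noise_pow_four_le_of_global {f : (∀ i, Ω i) → ℝ} (hf : ∀ x, f x ^ 2 ≤ 1) {r ε : ℝ}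
    (hglob : ∀ (R : Finset ι) z, (R.card : ℝ) ≤ r → fixedEnergy ν f R z ≤ ε) (hε : 0 ≤ ε)
    (hr : ∀ k : ℕ, r < k → (1 / 4 : ℝ) ^ k ≤ ε) :
    ∑ a, prodMeas ν a * noise (1 / 4) ν f a ^ 4 ≤ ε * ∑ a, prodMeas ν a * f a ^ 2 := by
  refine (sum_noise_pow_four_le h0 h1 f).trans ?_
  refine le_trans ?_ (mul_le_mul_of_nonneg_left (sum_splitEnergy_le h0 h1 f) hε)
  simp only [mul_sum]
  refine sum_le_sum fun c _ => sum_le_sum fun z _ => ?_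
  have hE := splitEnergy_nonneg h0 f c z
  have hw : (∏ i, splitWt (c i)) =
      (1 / 4 : ℝ) ^ (univ.filter (fun i => c i = none)).card * ∏ i, splitWtOne (c i) := by
    simp only [splitWt_eq, prod_mul_distrib]
    rw [prod_ite, prod_const, prod_const_one, mul_one]
  -- Only one of the two energy factors is bounded uniformly; the other is left to
  -- `sum_splitEnergy_le`.
  have hk : (1 / 4 : ℝ) ^ (univ.filter (fun i => c i = none)).card * splitEnergy ν f c z ≤ ε := by
    by_cases hc : ((univ.filter (fun i => c i = none)).card : ℝ) ≤ r
    · have : splitEnergy ν f c z ≤ ε := (splitEnergy_le h0 h1 f c z).trans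
        (sum_splitDiag_le f c z ε fun R hR => hglob R z
          (le_trans (by exact_mod_cast card_le_card hR) hc))
      exact (mul_le_of_le_one_left hE (pow_le_one₀ (by norm_num) (by norm_num))).trans this
    · have : splitEnergy ν f c z ≤ 1 := (splitEnergy_le h0 h1 f c z).trans
        (sum_splitDiag_le f c z 1 fun R _ => fixedEnergy_le_one h0 h1 hf R z)
      exact (mul_le_of_le_one_right (by positivity) this).trans (hr _ (not_le.1 hc))
  have hp : 0 ≤ (∏ i, splitWtOne (c i)) * prodMeas ν z * splitEnergy ν f c z :=
    mul_nonneg (mul_nonneg (prod_nonneg fun i _ => splitWtOne_nonneg _) (prodMeas_nonneg h0 z)) hE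
  have := mul_le_mul_of_nonneg_right hk hp
  rw [hw]
  linarith

end Product

/-! ### Comparison of a chain having a spectral gap with the noise operator. -/

section Contraction

open Finset

variable {S : Type*} [Fintype S] [DecidableEq S] {T : Matrix S S ℝ} {ν : S → ℝ}

lemma IsStationary.sum_mul_mulVec (h : IsStationary T ν) (g : S → ℝ) :
    ∑ a, ν a * T.mulVec g a = ∑ a, ν a * g a := by
  simpa only [dotProduct, h.stationary] using Matrix.dotProduct_mulVec ν T g

/-- Jensen's inequality on each row, then stationarity. -/
lemma IsStationary.sum_mul_mulVec_sq_le (h : IsStationary T ν) (g : S → ℝ) :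
    ∑ a, ν a * T.mulVec g a ^ 2 ≤ ∑ a, ν a * g a ^ 2 := by
  rw [← h.sum_mul_mulVec fun a => g a ^ 2]
  obtain ⟨hT0, hT1⟩ := Matrix.mem_rowStochastic_iff_sum.1 h.stochastic
  exact sum_le_sum fun a _ => mul_le_mul_of_nonneg_left (sq_sum_le _ (hT0 a) (hT1 a) g) (h.prob.1 a)

lemma IsStationary.sum_mul_mulVec_sq_le_of_gap (h : IsStationary T ν) {lam ρ : ℝ}
    (hgap : lam ≤ absSpectralGap T ν) (hρ : 1 - lam ≤ ρ) (g : S → ℝ) (hg : ∑ a, ν a * g a = 0) :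
    ∑ a, ν a * T.mulVec g a ^ 2 ≤ ρ ^ 2 * ∑ a, ν a * g a ^ 2 := by
  have hν0 : ∀ a, 0 ≤ ν a := h.prob.1
  have hunit : ∀ f : S → ℝ, ∑ a, ν a * f a = 0 → ∑ a, ν a * f a ^ 2 = 1 →
      ∑ a, ν a * T.mulVec f a ^ 2 ≤ ρ ^ 2 := by
    intro f hf0 hf1
    set A := {v : ℝ | ∃ f : S → ℝ, expect ν f = 0 ∧ expect ν (fun x => f x ^ 2) = 1 ∧
      v = expect ν (fun x => (T.mulVec f x) ^ 2)} with hA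
    -- Boundedness is essential: `sSup` of an unbounded set of reals is 0 by convention.
    have hbdd : BddAbove A := by
      refine ⟨1, ?_⟩
      rintro v ⟨f, -, hf, rfl⟩
      exact (h.sum_mul_mulVec_sq_le f).trans_eq hf
    have hmem : ∑ a, ν a * T.mulVec f a ^ 2 ∈ A := ⟨f, hf0, hf1, rfl⟩
    have hle := le_csSup hbdd hmem
    have hs : Real.sqrt (sSup A) ≤ ρ := by
      have : lam ≤ 1 - Real.sqrt (sSup A) := hgap
      linarith
    exact hle.trans (Real.sqrt_le_iff.1 hs).2
  have hV : 0 ≤ ∑ a, ν a * g a ^ 2 := sum_nonneg fun a _ => mul_nonneg (hν0 a) (sq_nonneg _)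
  rcases hV.eq_or_lt with hV | hV
  · rw [← hV, mul_zero, hV]
    exact h.sum_mul_mulVec_sq_le g
  · obtain ⟨V, hVdef⟩ : ∃ V, V = ∑ a, ν a * g a ^ 2 := ⟨_, rfl⟩
    rw [← hVdef] at hV ⊢
    have hr : (Real.sqrt V)⁻¹ ^ 2 = V⁻¹ := by rw [inv_pow, Real.sq_sqrt hV.le]
    have := hunit ((Real.sqrt V)⁻¹ • g)
      (by
        simp only [Pi.smul_apply, smul_eq_mul, mul_left_comm (ν _), ← mul_sum, hg, mul_zero])
      (by
        simp only [Pi.smul_apply, smul_eq_mul, mul_pow, hr, mul_left_comm (ν _), ← mul_sum,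
          ← hVdef]
        exact inv_mul_cancel₀ hV.ne')
    simp only [Matrix.mulVec_smul, Pi.smul_apply, smul_eq_mul, mul_pow, hr, mul_left_comm (ν _),
      ← mul_sum] at this
    rwa [inv_mul_le_iff₀ hV, mul_comm] at this

/-- A chain with a spectral gap contracts at least as much as a noise operator. -/
lemma IsStationary.sum_mul_mulVec_sq_le_noise (h : IsStationary T ν) {lam ρ : ℝ}
    (hgap : lam ≤ absSpectralGap T ν) (hρ : 1 - lam ≤ ρ) (g : S → ℝ) :
    ∑ a, ν a * (∑ x, T a x * g x) ^ 2 ≤ ∑ a, ν a * (∑ x, noiseKer ρ ν a x * g x) ^ 2 := by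
  have h1 : ∑ a, ν a = 1 := h.prob.2
  obtain ⟨-, hT1⟩ := Matrix.mem_rowStochastic_iff_sum.1 h.stochastic
  rw [sum_noiseKer_sq ρ ν h1]
  obtain ⟨m, hm⟩ : ∃ m, m = ∑ x, ν x * g x := ⟨_, rfl⟩
  rw [← hm]
  have h0 : ∑ a, ν a * (g a - m) = 0 := by
    simp only [mul_sub, sum_sub_distrib, ← sum_mul, h1, ← hm]; ring
  have key := h.sum_mul_mulVec_sq_le_of_gap hgap hρ (fun a => g a - m) h0
  -- Stationarity preserves mean zero, so the cross term between the mean and the centred part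
  -- vanishes.
  have hT0 : ∑ a, ν a * T.mulVec (fun a => g a - m) a = 0 := by rw [h.sum_mul_mulVec, h0]
  have hT : ∀ a, ∑ x, T a x * g x = m + T.mulVec (fun a => g a - m) a := by
    intro a
    simp only [Matrix.mulVec, dotProduct, mul_sub, sum_sub_distrib, ← sum_mul, hT1]; ring
  obtain ⟨G, hG⟩ : ∃ G, G = T.mulVec (fun a => g a - m) := ⟨_, rfl⟩
  rw [← hG] at key hT0 hT
  simp only [hT]
  have e1 : ∀ a, ν a * (m + G a) ^ 2 = m ^ 2 * ν a + 2 * m * (ν a * G a) + ν a * G a ^ 2 :=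
    fun a => by ring
  have e2 : ∀ a, ν a * (g a - m) ^ 2 = ν a * g a ^ 2 - 2 * m * (ν a * g a) + m ^ 2 * ν a :=
    fun a => by ring
  simp only [e2, sum_add_distrib, sum_sub_distrib, ← mul_sum, h1, ← hm] at key
  simp only [e1, sum_add_distrib, ← mul_sum, h1, hT0]
  linarith

end Contraction

/-! ### Law of two consecutive states of the stationary chain. -/

section Chain

open Finset

lemma IsMarkovChain.real_eq {S : Type*} [Fintype S] {T : Matrix S S ℝ} {ν : S → ℝ}
    {E : Type*} [MeasurableSpace E] {P : Measure E} [IsProbabilityMeasure P] {X : ℕ → E → S}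
    (hX : IsMarkovChain T ν P X) (hν : ∀ b, ∑ a, ν a * T a b = ν b) (k : ℕ) :
    (∀ a, P.real {e | X k e = a} = ν a) ∧
      ∀ a b, P.real {e | X k e = a ∧ X (k + 1) e = b} = ν a * T a b := by
  have hstep : ∀ k, (∀ a, P.real {e | X k e = a} = ν a) →
      ∀ a b, P.real {e | X k e = a ∧ X (k + 1) e = b} = ν a * T a b := by
    intro k hk a b
    -- The full past event discards the history.
    have := hX.markov k Set.univ a b
    simpa [hk] using this
  suffices h : ∀ a, P.real {e | X k e = a} = ν a from ⟨h, hstep k h⟩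
  induction k with
  | zero => exact hX.initial
  | succ k ih =>
    intro b
    have hU : {e | X (k + 1) e = b} = ⋃ a ∈ (univ : Finset S), {e | X k e = a ∧ X (k + 1) e = b} := by
      ext e; simp
    rw [hU, measureReal_biUnion_finset]
    · rw [← hν b]
      exact sum_congr rfl fun a _ => hstep k ih a b
    · intro a _ a' _ haa'
      refine Set.disjoint_left.2 fun e he he' => haa' (he.1.symm.trans he'.1)
    · exact fun a _ => (hX.measurable k a).inter (hX.measurable (k + 1) b)

lemma IsMarkovChain.real_mem_mem {S : Type*} [Fintype S] {T : Matrix S S ℝ} {ν : S → ℝ}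
    {E : Type*} [MeasurableSpace E] {P : Measure E} [IsProbabilityMeasure P] {X : ℕ → E → S}
    (hX : IsMarkovChain T ν P X) (hν : ∀ b, ∑ a, ν a * T a b = ν b) (k : ℕ) (F : Set S) :
    P.real {e | X k e ∈ F ∧ X (k + 1) e ∈ F} =
      ∑ a, ν a * (F.indicator 1 a * ∑ b, T a b * F.indicator 1 b) := by
  classical
  have hU : {e | X k e ∈ F ∧ X (k + 1) e ∈ F} =
      ⋃ p ∈ (univ.filter fun p : S × S => p.1 ∈ F ∧ p.2 ∈ F),
        {e | X k e = p.1 ∧ X (k + 1) e = p.2} := by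
    ext e; simp
  rw [hU, measureReal_biUnion_finset]
  · rw [sum_filter, Fintype.sum_prod_type]
    refine sum_congr rfl fun a _ => ?_
    simp only [mul_sum]
    refine sum_congr rfl fun b _ => ?_
    rw [(hX.real_eq hν k).2]
    by_cases ha : a ∈ F <;> by_cases hb : b ∈ F <;> simp [ha, hb]
  · intro p _ q _ hpq
    refine Set.disjoint_left.2 fun e he he' => hpq (Prod.ext (he.1.symm.trans he'.1)
      (he.2.symm.trans he'.2))
  · exact fun p _ => (hX.measurable k p.1).inter (hX.measurable (k + 1) p.2)

end Chain

/-! ### Small-set expansion for the noise operator. -/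

section SmallSet

open Finset

variable {ι : Type*} [Fintype ι] [DecidableEq ι] {Ω : ι → Type*} [∀ i, Fintype (Ω i)]
  [∀ i, DecidableEq (Ω i)]

/-- Links globalness, stated on the coordinates outside `R`, with the form on the full product that
tensorisation yields. -/
lemma fixedEnergy_eq_expect (ν : ∀ i, Ω i → ℝ) (f : (∀ i, Ω i) → ℝ) (R : Finset ι) (z : ∀ i, Ω i) :
    fixedEnergy ν f R z = expect (prodMeas (fun i : {i // i ∉ R} => ν i))
      (fun y => restrict f R (fun i => z i) y ^ 2) := by
  have hp : ∀ x : ∀ i, Ω i, (∏ i, if i ∈ R then (if x i = z i then (1 : ℝ) else 0) else ν i (x i)) =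
      (∏ i : {i // i ∈ R}, if x i = z i then 1 else 0) * ∏ i : {i // i ∉ R}, ν i (x i) := by
    intro x
    rw [← Fintype.prod_subtype_mul_prod_subtype (fun i => i ∈ R)]
    congr 1
    · exact prod_congr (by ext; simp) fun i _ => by rw [if_pos i.2]
    · exact prod_congr (by ext; simp) fun i _ => by rw [if_neg i.2]
  simp only [fixedEnergy, hp]
  rw [← (Equiv.piEquivPiSubtypeProd (fun i => i ∈ R) Ω).symm.sum_comp, Fintype.sum_prod_type,
    sum_comm]
  refine sum_congr rfl fun y _ => ?_
  rw [sum_eq_single (fun i : {i // i ∈ R} => z i)]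
  · have e1 : ∏ i : {i // i ∈ R}, (if (Equiv.piEquivPiSubtypeProd (fun i => i ∈ R) Ω).symm
        (fun i => z i, y) i = z i then (1 : ℝ) else 0) = 1 :=
      prod_eq_one fun i _ => by simp [Equiv.piEquivPiSubtypeProd]
    have e2 : ∏ i : {i // i ∉ R}, ν i ((Equiv.piEquivPiSubtypeProd (fun i => i ∈ R) Ω).symm
        (fun i => z i, y) i) = prodMeas (fun i : {i // i ∉ R} => ν i) y :=
      prod_congr rfl fun i _ => by simp [Equiv.piEquivPiSubtypeProd, i.2]
    rw [e1, e2, one_mul]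
    rfl
  · intro a _ ha
    obtain ⟨i, hi⟩ := Function.ne_iff.1 ha
    rw [prod_eq_zero (mem_univ i) (by simp [Equiv.piEquivPiSubtypeProd, hi]), zero_mul, zero_mul]
  · simp

variable {ν : ∀ i, Ω i → ℝ} (h0 : ∀ i x, 0 ≤ ν i x) (h1 : ∀ i, ∑ x, ν i x = 1)

lemma fixedEnergy_empty (f : (∀ i, Ω i) → ℝ) (z : ∀ i, Ω i) :
    fixedEnergy ν f ∅ z = ∑ x, prodMeas ν x * f x ^ 2 := by
  simp [fixedEnergy, prodMeas]

include h0 h1 in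
/-- Small-set expansion for the noise operator and global sets. -/
lemma sum_noise_half_sq_le {f : (∀ i, Ω i) → ℝ} (hf : ∀ x, f x ^ 2 = f x) {ε : ℝ} (hε : 0 < ε)
    (hN : ∑ a, prodMeas ν a * f a ^ 2 ≤ ε)
    (h4 : ∑ a, prodMeas ν a * noise (1 / 4) ν f a ^ 4 ≤ ε * ∑ a, prodMeas ν a * f a ^ 2) :
    ∑ a, prodMeas ν a * noise (1 / 2) ν f a ^ 2 ≤ ε ^ (5 / 4 : ℝ) := by
  have hw := prodMeas_nonneg h0
  set N := ∑ a, prodMeas ν a * f a ^ 2 with hNdef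
  set A := ∑ a, prodMeas ν a * noise (1 / 2) ν f a ^ 2 with hA
  have hN0 : 0 ≤ N := sum_nonneg fun a _ => mul_nonneg (hw a) (sq_nonneg _)
  have hA0 : 0 ≤ A := sum_nonneg fun a _ => mul_nonneg (hw a) (sq_nonneg _)
  have hA' : A = ∑ a, prodMeas ν a * (f a * noise (1 / 4) ν f a) := by
    rw [hA, sum_noise_sq h1]; norm_num
  set g := noise (1 / 4) ν f
  -- Since f² = f, two applications of Cauchy–Schwarz amount to Hölder with exponents 4/3 and 4: A⁴
  -- ≤ N³ 𝔼g⁴.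
  have c1 : A ^ 2 ≤ N * ∑ a, prodMeas ν a * (f a * g a) ^ 2 := by
    have := sum_mul_sq_le (prodMeas ν) f (fun a => f a * g a) hw
    refine le_trans (le_of_eq ?_) this
    rw [hA']
    congr 1
    exact sum_congr rfl fun a _ => by rw [← mul_assoc (f a), ← sq, hf]
  have c2 : (∑ a, prodMeas ν a * (f a * g a) ^ 2) ^ 2 ≤ N * ∑ a, prodMeas ν a * g a ^ 4 := by
    have := sum_mul_sq_le (prodMeas ν) f (fun a => g a ^ 2) hw
    refine le_trans (le_of_eq ?_) (this.trans_eq ?_)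
    · congr 1
      exact sum_congr rfl fun a _ => by rw [mul_pow, hf]
    · congr 1
      exact sum_congr rfl fun a _ => by rw [← pow_mul]
  have c3 : A ^ 4 ≤ ε ^ 5 := by
    calc A ^ 4 = (A ^ 2) ^ 2 := by ring
      _ ≤ (N * ∑ a, prodMeas ν a * (f a * g a) ^ 2) ^ 2 := pow_le_pow_left₀ (sq_nonneg _) c1 2
      _ = N ^ 2 * (∑ a, prodMeas ν a * (f a * g a) ^ 2) ^ 2 := by ring
      _ ≤ N ^ 2 * (N * (ε * N)) := mul_le_mul_of_nonneg_left
          (c2.trans (mul_le_mul_of_nonneg_left h4 hN0)) (sq_nonneg _)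
      _ = ε * N ^ 4 := by ring
      _ ≤ ε * ε ^ 4 := mul_le_mul_of_nonneg_left (pow_le_pow_left₀ hN0 hN 4) hε.le
      _ = ε ^ 5 := by ring
  refine le_of_pow_le_pow_left₀ (n := 4) (by norm_num) (by positivity) (c3.trans_eq ?_)
  rw [← Real.rpow_mul_natCast hε.le, ← Real.rpow_natCast]
  norm_num

include h0 h1 in
/-- Small-set expansion passes from a noise rate `ρ ^ (2 ^ m)` to the rate `ρ`. -/
lemma sum_noise_sq_le {f : (∀ i, Ω i) → ℝ} {ε : ℝ} (hε : 0 < ε)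
    (hN : ∑ a, prodMeas ν a * f a ^ 2 ≤ ε)
    (hhalf : ∑ a, prodMeas ν a * noise (1 / 2) ν f a ^ 2 ≤ ε ^ (5 / 4 : ℝ)) (m : ℕ) :
    ∀ ρ : ℝ, ρ ^ 2 ^ m = 1 / 2 →
      ∑ a, prodMeas ν a * noise ρ ν f a ^ 2 ≤ ε ^ (1 + 1 / 4 / 2 ^ m : ℝ) := by
  have hw := prodMeas_nonneg h0
  induction m with
  | zero =>
    intro ρ hρ
    have : ρ = 1 / 2 := by simpa using hρ
    rw [this]
    refine hhalf.trans_eq ?_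
    norm_num
  | succ m ih =>
    intro ρ hρ
    have h2 := ih (ρ ^ 2) (by rw [← pow_mul, ← hρ, pow_succ, mul_comm])
    have hA0 : 0 ≤ ∑ a, prodMeas ν a * noise ρ ν f a ^ 2 :=
      sum_nonneg fun a _ => mul_nonneg (hw a) (sq_nonneg _)
    have hB0 : 0 ≤ ∑ a, prodMeas ν a * noise (ρ ^ 2) ν f a ^ 2 :=
      sum_nonneg fun a _ => mul_nonneg (hw a) (sq_nonneg _)
    refine le_of_pow_le_pow_left₀ (n := 2) (by norm_num) (by positivity) ?_
    -- Taking the square root averages the exponents 1 and 1 + 1/(4·2^m), which halves the excess.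
    calc _ = (∑ a, prodMeas ν a * (f a * noise (ρ ^ 2) ν f a)) ^ 2 := by rw [sum_noise_sq h1]
      _ ≤ _ := sum_mul_sq_le (prodMeas ν) f (noise (ρ ^ 2) ν f) hw
      _ ≤ ε * ε ^ (1 + 1 / 4 / 2 ^ m : ℝ) := mul_le_mul hN h2 hB0 hε.le
      _ = ε ^ (1 + (1 + 1 / 4 / 2 ^ m) : ℝ) := by rw [Real.rpow_add hε 1 (1 + _), Real.rpow_one]
      _ = _ := by
        rw [← Real.rpow_mul_natCast hε.le]
        congr 1
        push_cast
        rw [pow_succ]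
        field_simp
        ring

end SmallSet

/-- The root 2^{-1/2^k} tends to 1, so it eventually exceeds `b`. Since 2^k ≥ k, any `k` with max(b,
0)^k < 1/2 works. -/
lemma exists_pow_two_pow_eq_half {b : ℝ} (hb : b < 1) :
    ∃ (m : ℕ) (ρ : ℝ), b ≤ ρ ∧ ρ ^ 2 ^ m = 1 / 2 := by
  obtain ⟨k, hk⟩ := exists_pow_lt_of_lt_one (show (0 : ℝ) < 1 / 2 by norm_num)
    (show max b 0 < 1 from max_lt hb one_pos)
  refine ⟨k, (1 / 2 : ℝ) ^ ((2 ^ k : ℕ) : ℝ)⁻¹, (le_max_left b 0).trans ?_, ?_⟩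
  · refine le_of_pow_le_pow_left₀ (n := 2 ^ k) (by positivity) (by positivity) ?_
    rw [Real.rpow_inv_natCast_pow (by norm_num) (by positivity)]
    exact (pow_le_pow_of_le_one (le_max_right b 0) (max_lt hb one_pos).le
      Nat.lt_two_pow_self.le).trans hk.le
  · exact Real.rpow_inv_natCast_pow (by norm_num) (by positivity)

end GlobalSSE

end

/-! ### Assembly and choice of constants. -/

open GlobalSSE in
theorem theorem4p2 (lam : ℝ) (hlam : 0 < lam) :
    ∃ c : ℝ, 0 < c ∧
      ∀ (n : ℕ) (Ω : Fin n → Type*) [∀ i, Fintype (Ω i)] [∀ i, DecidableEq (Ω i)]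
        (T : ∀ i, Matrix (Ω i) (Ω i) ℝ) (ν : ∀ i, Ω i → ℝ),
        (∀ i, GlobalSSE.IsStationary (T i) (ν i)) →
        (∀ i, lam ≤ GlobalSSE.absSpectralGap (T i) (ν i)) →
        ∀ (E : Type*) [MeasurableSpace E] (P : Measure E) [IsProbabilityMeasure P]
          (X : ℕ → E → (∀ i, Ω i)),
          GlobalSSE.IsMarkovChain (GlobalSSE.prodChain T) (GlobalSSE.prodMeas ν) P X →
          ∀ (μ : ℝ), 0 < μ → μ < 1 / 16 →
            ∀ F : Set (∀ i, Ω i),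
              GlobalSSE.IsGlobal ν (Real.log (1 / μ)) (μ ^ (1 - c)) F →
              ∀ k : ℕ, P.real {e | X k e ∈ F ∧ X (k + 1) e ∈ F} ≤ μ ^ (1 + c) := by
  obtain ⟨m, ρ, hρ, hρm⟩ := exists_pow_two_pow_eq_half (b := 1 - lam) (by linarith)
  obtain ⟨t, ht⟩ : ∃ t : ℝ, t = 1 / 4 / 2 ^ m := ⟨_, rfl⟩
  have ht0 : 0 < t := by rw [ht]; positivity
  have ht1 : t ≤ 1 / 4 := by
    rw [ht]; exact div_le_self (by norm_num) (one_le_pow₀ (by norm_num))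
  -- The final bound is ε^(1 + t/2) with ε = μ^(1 - t/8), and (1 - t/8)(1 + t/2) ≥ 1 + t/8 because 0
  -- < t ≤ 1/4.
  refine ⟨t / 8, by positivity, ?_⟩
  intro n Ω _ _ T ν hst hgap E _ P _ X hX μ hμ0 hμ1 F hF k
  have h0 : ∀ i x, 0 ≤ ν i x := fun i => (hst i).prob.1
  have h1 : ∀ i, ∑ x, ν i x = 1 := fun i => (hst i).prob.2
  have hw := prodMeas_nonneg h0
  obtain ⟨f, hfdef⟩ : ∃ f : (∀ i, Ω i) → ℝ, f = F.indicator 1 := ⟨_, rfl⟩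
  have hf : ∀ x, f x ^ 2 = f x := fun x => by
    by_cases hx : x ∈ F <;> simp [hfdef, hx]
  have hf1 : ∀ x, f x ^ 2 ≤ 1 := fun x => by
    by_cases hx : x ∈ F <;> simp [hfdef, hx]
  obtain ⟨ε, hεdef⟩ : ∃ ε : ℝ, ε = μ ^ (1 - t / 8) := ⟨_, rfl⟩
  have hε : 0 < ε := hεdef ▸ Real.rpow_pos_of_pos hμ0 _
  have hμε : μ ≤ ε := by
    rw [hεdef]
    conv_lhs => rw [← Real.rpow_one μ]
    exact Real.rpow_le_rpow_of_exponent_ge hμ0 (by linarith) (by linarith)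
  have hlog : 0 ≤ Real.log (1 / μ) := Real.log_nonneg (by rw [le_div_iff₀ hμ0]; linarith)
  have hglob : ∀ (R : Finset (Fin n)) z, (R.card : ℝ) ≤ Real.log (1 / μ) →
      fixedEnergy ν f R z ≤ ε := by
    intro R z hR
    rw [fixedEnergy_eq_expect, hfdef, hεdef]
    exact hF R hR _
  -- This is where the threshold log(1/μ) comes from: as 1/4 ≤ 1/e, more than log(1/μ) centred
  -- coordinates gain a factor at most μ.
  have hr : ∀ k : ℕ, Real.log (1 / μ) < k → (1 / 4 : ℝ) ^ k ≤ ε := by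
    intro k hk
    refine le_trans ?_ hμε
    have h4 : (1 / 4 : ℝ) ≤ Real.exp (-1) := by
      rw [Real.exp_neg, ← one_div]
      exact one_div_le_one_div_of_le (Real.exp_pos 1) (by linarith [Real.exp_one_lt_d9])
    calc (1 / 4 : ℝ) ^ k ≤ Real.exp (-1) ^ k := pow_le_pow_left₀ (by norm_num) h4 k
      _ = Real.exp (-k) := by rw [← Real.exp_nat_mul]; ring_nf
      _ ≤ Real.exp (Real.log μ) := by
        rw [one_div, Real.log_inv] at hk
        exact Real.exp_le_exp.2 (by linarith)
      _ = μ := Real.exp_log hμ0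
  have hN : ∑ a, prodMeas ν a * f a ^ 2 ≤ ε := by
    rcases isEmpty_or_nonempty (∀ i, Ω i) with hemp | ⟨⟨z⟩⟩
    · simpa using hε.le
    · rw [← fixedEnergy_empty f z]
      exact hglob ∅ z (by simpa using hlog)
  have hnoise := sum_noise_sq_le h0 h1 hε hN (sum_noise_half_sq_le h0 h1 hf hε hN
    (sum_noise_pow_four_le_of_global h0 h1 hf1 hglob hε.le hr)) m ρ hρm
  have hT := tensor_mono ν T ν (fun i => noiseKer ρ (ν i)) h0
    (fun i g => (hst i).sum_mul_mulVec_sq_le_noise (hgap i) hρ g) f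
  have hTf : ∑ a, prodMeas ν a * (∑ b, prodChain T a b * f b) ^ 2 ≤ ε ^ (1 + t) := by
    rw [ht]; exact hT.trans hnoise
  rw [hX.real_mem_mem (fun b => ?_) k F, ← hfdef]
  · have hA : (∑ a, prodMeas ν a * (f a * ∑ b, prodChain T a b * f b)) ^ 2 ≤ (ε ^ (1 + t / 2)) ^ 2 :=
      calc _ ≤ _ := sum_mul_sq_le (prodMeas ν) f _ hw
        _ ≤ ε * ε ^ (1 + t) := mul_le_mul hN hTf
          (Finset.sum_nonneg fun a _ => mul_nonneg (hw a) (sq_nonneg _)) hε.le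
        _ = ε ^ (1 + (1 + t)) := by rw [Real.rpow_add hε 1 (1 + t), Real.rpow_one]
        _ = _ := by
          rw [← Real.rpow_mul_natCast hε.le]
          congr 1
          push_cast
          ring
    refine (le_of_sq_le_sq hA (by positivity)).trans ?_
    rw [hεdef, ← Real.rpow_mul hμ0.le]
    refine Real.rpow_le_rpow_of_exponent_ge hμ0 (by linarith) ?_
    nlinarith
  · simp only [prodMeas, prodChain, ← Finset.prod_mul_distrib]
    rw [sum_prod_eq_prod_sum (fun i x => ν i x * T i x (b i))]
    exact Finset.prod_congr rfl fun i _ => congrFun (hst i).stationary (b i)
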